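/- Let $D$ be a finitely generated abelian group and let $A=\bigoplus_{e\in D}A_e$ be a $D$-graded integral domain, generated as an $A_0$-algebra by finitely many homogeneous elements $x_1,\dots,x_r$. Assume that $A_0$ is a field and that $A^\times=A_0^\times$. A homogeneous element $f\in A$ is called *relevant* if the degrees of the homogeneous units of the $D$-graded ring $A_f$ form a subgroup of finite index of $D$; write $A_{(f)}$ for the degree-$0$ part of $A_f$. Let $X=\operatorname{Proj}_{\mathrm{MH}}A$ be the multihomogeneous space of $A$, that is, the scheme obtained as the union of the open subschemes $D_+(f)=\operatorname{Spec}A_{(f)}$, $f$ relevant, with $D_+(f)\cap D_+(g)=D_+(fg)$, inside the quotient of $\operatorname{Spec}A$ by the diagonalizable group scheme $\operatorname{Spec}A_0[D]$. Its points $p$ correspond to the homogeneous ideals $I_p\subset A$ such that the homogeneous elements outside $I_p$ form a multiplicatively closed set containing a relevant element, and the stalk $\mathcal O_{X,p}$ is the degree-$0$ part of the localization of $A$ at this set. For $d\in D$ let $A(d)$ be the graded $A$-module with $A(d)_e=A_{e+d}$, and let $\mathcal O_X(d)=\widetilde{A(d)}$ be the associated sheaf of $\mathcal O_X$-modules: its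 sections over an open set $U$ are the functions $s$ that assign to $p\in U$ an element $s(p)$ of the degree-$0$ part $A(d)_{(I_p)}$ of the localization of $A(d)$ at the homogeneous elements outside $I_p$, and that are locally of the form $m/a$ with $m\in A(d)$ and $a\in A$ homogeneous of the same degree, $a$ outside the ideals $I_p$. For a relevant $f$ let $D_f\subset D$ be the subgroup generated by all $e\in D$ such that some $a\in A_e$ divides $f^N$ for some $N>0$. Let $d\in D$ be such that $d\in D_f$ for every relevant element $f\in A$. Then $\mathcal O_X(d)$ is a line bundle on $X$, i.e. $X$ is covered by open subsets $U$ with $\mathcal O_X(d)|_U\cong\mathcal O_U$. -/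

import Mathlib

universe u v

noncomputable section

namespace MultiProj

open CategoryTheory TopologicalSpace Opposite AlgebraicGeometry

variable {D : Type v} [AddCommGroup D] [DecidableEq D] {A : Type u} [CommRing A]
variable (𝒜 : D → AddSubgroup A) [GradedRing 𝒜]
variable {M : Type u} [AddCommGroup M] [Module A M] (ℳ : D → AddSubgroup M)
  [SetLike.GradedSMul 𝒜 ℳ]

/-- The degree `e` part of the localization `S⁻¹M` of a graded `A`-module `M`: all fractions `m / s`
with `m ∈ M` and `s ∈ S` homogeneous and `deg m = e + deg s`. -/
def locPart (S : Submonoid A) (e : D) : AddSubgroup (LocalizedModule S M) where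
  carrier := {z | ∃ (j : D) (m : M) (s : S), m ∈ ℳ (e + j) ∧ (s : A) ∈ 𝒜 j ∧
    z = LocalizedModule.mk m s}
  zero_mem' := ⟨0, 0, 1, zero_mem _, SetLike.GradedOne.one_mem, (LocalizedModule.zero_mk 1).symm⟩
  add_mem' := by
    rintro _ _ ⟨i, m, s, hm, hs, rfl⟩ ⟨j, n, t, hn, ht, rfl⟩
    refine ⟨i + j, t • m + s • n, s * t, add_mem ?_ ?_, SetLike.mul_mem_graded hs ht,
      LocalizedModule.mk_add_mk⟩
    · have h := SetLike.GradedSMul.smul_mem (A := 𝒜) (B := ℳ) ht hm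
      rwa [vadd_eq_add, show j + (e + i) = e + (i + j) by abel] at h
    · have h := SetLike.GradedSMul.smul_mem (A := 𝒜) (B := ℳ) hs hn
      rwa [vadd_eq_add, show i + (e + j) = e + (i + j) by abel] at h
  neg_mem' := by
    rintro _ ⟨i, m, s, hm, hs, rfl⟩
    exact ⟨i, -m, s, neg_mem hm, hs, (LocalizedModule.mk_neg).symm⟩

/-- A `D`-graded ring `R` is periodic if the degrees of its homogeneous units form a subgroup of
finite index of `D`. (The set of these degrees is a subgroup already, so that `closure` does not
enlarge it.) -/
def IsPeriodic {R : Type u} [CommRing R] (ℛ : D → AddSubgroup R) : Prop :=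
  (AddSubgroup.closure {e : D | ∃ w ∈ ℛ e, IsUnit w}).FiniteIndex

/-- A homogeneous element `f` is relevant if the graded ring `A_f` is periodic. -/
def IsRelevant (f : A) : Prop :=
  SetLike.IsHomogeneousElem 𝒜 f ∧
    IsPeriodic (R := Localization (Submonoid.powers f)) (locPart 𝒜 𝒜 (Submonoid.powers f))

/-- The subgroup `D_f` of `D` generated by the degrees of the homogeneous divisors of the powers
`f ^ N`, `N > 0`. -/
def divisorDegrees (f : A) : AddSubgroup D :=
  AddSubgroup.closure {e : D | ∃ a ∈ 𝒜 e, ∃ N : ℕ, 0 < N ∧ a ∣ f ^ N}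

/-- The degree-zero subring of `S⁻¹A`. For `S = {1, f, f², …}` this is `A_(f)`. -/
def degZero (S : Submonoid A) : Subring (Localization S) where
  __ := locPart 𝒜 𝒜 S 0
  one_mem' := ⟨0, 1, 1, by simpa using SetLike.GradedOne.one_mem (A := 𝒜), SetLike.GradedOne.one_mem,
    OreLocalization.one_def⟩
  mul_mem' := by
    rintro _ _ ⟨i, m, s, hm, hs, rfl⟩ ⟨j, n, t, hn, ht, rfl⟩
    rw [zero_add] at hm hn
    exact ⟨i + j, m * n, s * t, by simpa using SetLike.mul_mem_graded hm hn,
      SetLike.mul_mem_graded hs ht, by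
        exact LocalizedModule.mk_mul_mk (A := A)⟩

/-- The points of the multihomogeneous space: the homogeneous ideals of `A` such that the homogeneous
elements outside form a multiplicatively closed set which contains a relevant element. Those points
with `f` outside the ideal, for a fixed relevant `f`, are the points of `Spec A_(f)`; see `toPrime`,
`ofPrime` and `isIso_toSpec` below. -/
@[ext]
structure Point where
  ideal : HomogeneousIdeal 𝒜
  one_notMem : (1 : A) ∉ ideal
  mem_or_mem : ∀ {a b : A}, SetLike.IsHomogeneousElem 𝒜 a → SetLike.IsHomogeneousElem 𝒜 b →
    a * b ∈ ideal → a ∈ ideal ∨ b ∈ ideal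
  exists_relevant : ∃ f : A, IsRelevant 𝒜 f ∧ f ∉ ideal

variable {𝒜}

/-- The multiplicative set of homogeneous elements outside the ideal of a point. -/
def Point.compl (x : Point 𝒜) : Submonoid A where
  carrier := {a | SetLike.IsHomogeneousElem 𝒜 a ∧ a ∉ x.ideal}
  one_mem' := ⟨SetLike.isHomogeneousElem_one 𝒜, x.one_notMem⟩
  mul_mem' := fun ha hb => ⟨ha.1.mul hb.1, fun h => (x.mem_or_mem ha.1 hb.1 h).elim ha.2 hb.2⟩

variable (𝒜)

/-- The set `D_+(f)` of points whose ideal does not contain `f`. -/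
def basicSet (f : A) : Set (Point 𝒜) := {x | f ∉ x.ideal}

/-- The topology generated by the sets `D_+(f)`, `f` homogeneous. -/
instance : TopologicalSpace (Point 𝒜) :=
  TopologicalSpace.generateFrom {U | ∃ f : A, SetLike.IsHomogeneousElem 𝒜 f ∧ U = basicSet 𝒜 f}

/-- The underlying topological space. -/
abbrev top : TopCat.{u} := TopCat.of (Point 𝒜)

variable {𝒜}

/-- The localization of `M` at the homogeneous elements outside the ideal of `x`. Its degree-zero
part is `M_(x)`. -/
abbrev Point.LocAt (M : Type u) [AddCommGroup M] [Module A M] (x : Point 𝒜) : Type u :=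
  LocalizedModule x.compl M

/-- A function on `U` is a fraction if it is `m / a` at all points, for some homogeneous `m ∈ M` and
`a ∈ A` of the same degree. In particular its values lie in the degree-zero parts `M_(x)`. -/
def IsFraction {U : Opens (top 𝒜)} (s : ∀ x : U, Point.LocAt (𝒜 := 𝒜) M x.1) : Prop :=
  ∃ (j : D) (m : M) (a : A), m ∈ ℳ j ∧ a ∈ 𝒜 j ∧
    ∀ x : U, ∃ h : a ∈ Point.compl (𝒜 := 𝒜) x.1, s x = LocalizedModule.mk m ⟨a, h⟩

variable (𝒜)

/-- `IsFraction` passes to smaller open sets. -/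
def isFractionPrelocal :
    TopCat.PrelocalPredicate (fun x : top 𝒜 => Point.LocAt (𝒜 := 𝒜) M x) where
  pred s := IsFraction ℳ s
  res := by
    rintro V U i s ⟨j, m, a, hm, ha, w⟩
    exact ⟨j, m, a, hm, ha, fun x => w ⟨x.1, i.le x.2⟩⟩

/-- The functions which are locally fractions. -/
def isLocallyFraction : TopCat.LocalPredicate (fun x : top 𝒜 => Point.LocAt (𝒜 := 𝒜) M x) :=
  (isFractionPrelocal 𝒜 ℳ).sheafify

/-- The functions on `U` which are locally fractions form a group. -/
def sections (U : Opens (top 𝒜)) : AddSubgroup (∀ x : U, Point.LocAt (𝒜 := 𝒜) M x.1) where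
  carrier := {s | (isLocallyFraction 𝒜 ℳ).pred s}
  zero_mem' x := ⟨U, x.2, 𝟙 _, 0, 0, 1, zero_mem _, SetLike.GradedOne.one_mem,
    fun y => ⟨one_mem _, (LocalizedModule.zero_mk _).symm⟩⟩
  add_mem' := by
    rintro s t hs ht x
    obtain ⟨V, hV, iV, i, m, a, hm, ha, hs⟩ := hs x
    obtain ⟨W, hW, iW, j, n, b, hn, hb, ht⟩ := ht x
    refine ⟨V ⊓ W, ⟨hV, hW⟩, Opens.infLELeft _ _ ≫ iV, i + j, b • m + a • n, a * b,
      add_mem ?_ ?_, SetLike.mul_mem_graded ha hb, fun y => ?_⟩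
    · rw [add_comm i j]; exact SetLike.GradedSMul.smul_mem hb hm
    · exact SetLike.GradedSMul.smul_mem ha hn
    · obtain ⟨h1, e1⟩ := hs ⟨y.1, y.2.1⟩
      obtain ⟨h2, e2⟩ := ht ⟨y.1, y.2.2⟩
      exact ⟨mul_mem h1 h2, congr($e1 + $e2).trans LocalizedModule.mk_add_mk⟩
  neg_mem' := by
    rintro s hs x
    obtain ⟨V, hV, iV, i, m, a, hm, ha, hs⟩ := hs x
    refine ⟨V, hV, iV, i, -m, a, neg_mem hm, ha, fun y => ?_⟩
    obtain ⟨h1, e1⟩ := hs y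
    exact ⟨h1, congr(-$e1).trans LocalizedModule.mk_neg.symm⟩

/-- For `M = A` they form a ring. -/
def sectionsRing (U : Opens (top 𝒜)) : Subring (∀ x : U, Point.LocAt (𝒜 := 𝒜) A x.1) where
  __ := sections 𝒜 𝒜 U
  one_mem' x := ⟨U, x.2, 𝟙 _, 0, 1, 1, SetLike.GradedOne.one_mem, SetLike.GradedOne.one_mem,
    fun y => ⟨one_mem _, OreLocalization.one_def⟩⟩
  mul_mem' := by
    rintro s t hs ht x
    obtain ⟨V, hV, iV, i, m, a, hm, ha, hs⟩ := hs x
    obtain ⟨W, hW, iW, j, n, b, hn, hb, ht⟩ := ht x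
    refine ⟨V ⊓ W, ⟨hV, hW⟩, Opens.infLELeft _ _ ≫ iV, i + j, m * n, a * b,
      SetLike.mul_mem_graded hm hn, SetLike.mul_mem_graded ha hb, fun y => ?_⟩
    obtain ⟨h1, e1⟩ := hs ⟨y.1, y.2.1⟩
    obtain ⟨h2, e2⟩ := ht ⟨y.1, y.2.2⟩
    exact ⟨mul_mem h1 h2, congr($e1 * $e2).trans (LocalizedModule.mk_mul_mk (A := A))⟩

/-- In general they form a module over that ring. -/
def sectionsModule (U : Opens (top 𝒜)) :
    Submodule (sectionsRing 𝒜 U) (∀ x : U, Point.LocAt (𝒜 := 𝒜) M x.1) where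
  __ := sections 𝒜 ℳ U
  smul_mem' := by
    rintro ⟨r, hr⟩ s hs x
    obtain ⟨V, hV, iV, i, m, a, hm, ha, hr⟩ := hr x
    obtain ⟨W, hW, iW, j, n, b, hn, hb, hs⟩ := hs x
    refine ⟨V ⊓ W, ⟨hV, hW⟩, Opens.infLELeft _ _ ≫ iV, i + j, m • n, a * b,
      SetLike.GradedSMul.smul_mem hm hn, SetLike.mul_mem_graded ha hb, fun y => ?_⟩
    obtain ⟨h1, e1⟩ := hr ⟨y.1, y.2.1⟩
    obtain ⟨h2, e2⟩ := hs ⟨y.1, y.2.2⟩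
    exact ⟨mul_mem h1 h2, congr($e1 • $e2).trans (LocalizedModule.mk_smul_mk ..)⟩

/-- The sheaf of sets of functions which are locally fractions. -/
def sheafInType : TopCat.Sheaf (Type u) (top 𝒜) :=
  TopCat.subsheafToTypes (isLocallyFraction 𝒜 ℳ)

instance (U : (Opens (top 𝒜))ᵒᵖ) : AddCommGroup ((sheafInType 𝒜 ℳ).1.obj U) :=
  (sections 𝒜 ℳ U.unop).toAddCommGroup

instance (U : (Opens (top 𝒜))ᵒᵖ) : CommRing ((sheafInType 𝒜 𝒜).1.obj U) :=
  (sectionsRing 𝒜 U.unop).toCommRing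

instance (U : (Opens (top 𝒜))ᵒᵖ) :
    Module ((sheafInType 𝒜 𝒜).1.obj U) ((sheafInType 𝒜 ℳ).1.obj U) :=
  inferInstanceAs (Module (sectionsRing 𝒜 U.unop) (sectionsModule 𝒜 ℳ U.unop))

/-- The structure sheaf as a presheaf of rings. -/
def structurePresheaf : TopCat.Presheaf CommRingCat.{u} (top 𝒜) where
  obj U := .of ((sheafInType 𝒜 𝒜).1.obj U)
  map i := CommRingCat.ofHom
    { toFun := (sheafInType 𝒜 𝒜).1.map i
      map_add' _ _ := rfl
      map_mul' _ _ := rfl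
      map_one' := rfl
      map_zero' := rfl }

/-- The structure sheaf. -/
def structureSheaf : TopCat.Sheaf CommRingCat.{u} (top 𝒜) :=
  ⟨structurePresheaf 𝒜, (TopCat.Presheaf.isSheaf_iff_isSheaf_comp (forget CommRingCat) _).2
    (sheafInType 𝒜 𝒜).2⟩

/-- The presheaf of abelian groups underlying `M~`. -/
def abPresheaf : TopCat.Presheaf Ab.{u} (top 𝒜) where
  obj U := .of ((sheafInType 𝒜 ℳ).1.obj U)
  map i := AddCommGrpCat.ofHom
    { toFun := (sheafInType 𝒜 ℳ).1.map i
      map_add' _ _ := rfl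
      map_zero' := rfl }

instance (U : (Opens (top 𝒜))ᵒᵖ) : Module ((structurePresheaf 𝒜 ⋙ forget₂ CommRingCat RingCat).obj U)
   ((abPresheaf 𝒜 ℳ).obj U) :=
   inferInstanceAs (Module ((sheafInType 𝒜 𝒜).1.obj U) ((sheafInType 𝒜 ℳ).1.obj U))

/-- `M~` as a presheaf of modules over the structure sheaf. -/
def modulePresheaf : PresheafOfModules (structurePresheaf 𝒜 ⋙ forget₂ CommRingCat RingCat) :=
  .ofPresheaf (abPresheaf 𝒜 ℳ) fun _ _ _ _ _ => rfl


lemma mem_locPart {S : Submonoid A} {e : D} {z : Localization S} :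
    z ∈ locPart 𝒜 𝒜 S e ↔ ∃ (j : D) (a : A) (s : S), a ∈ 𝒜 (e + j) ∧ (s : A) ∈ 𝒜 j ∧
      z = IsLocalization.mk' (Localization S) a s := by
  simp only [← Localization.mk_eq_mk'_apply]
  exact Iff.rfl

lemma mem_degZero {S : Submonoid A} {z : Localization S} :
    z ∈ degZero 𝒜 S ↔ z ∈ locPart 𝒜 𝒜 S 0 := Iff.rfl

lemma mul_mem_locPart {S : Submonoid A} {d e : D} {y z : Localization S}
    (hy : y ∈ locPart 𝒜 𝒜 S d) (hz : z ∈ locPart 𝒜 𝒜 S e) : y * z ∈ locPart 𝒜 𝒜 S (d + e) := by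
  rw [mem_locPart] at *
  obtain ⟨i, a, s, ha, hs, rfl⟩ := hy
  obtain ⟨j, b, t, hb, ht, rfl⟩ := hz
  refine ⟨i + j, a * b, s * t, ?_, SetLike.mul_mem_graded hs ht, (IsLocalization.mk'_mul ..).symm⟩
  rw [show d + e + (i + j) = (d + i) + (e + j) by abel]
  exact SetLike.mul_mem_graded ha hb

lemma algebraMap_mem_locPart (S : Submonoid A) {e : D} {a : A} (ha : a ∈ 𝒜 e) :
    algebraMap A (Localization S) a ∈ locPart 𝒜 𝒜 S e :=
  (mem_locPart 𝒜).2 ⟨0, a, 1, by simpa using ha, SetLike.GradedOne.one_mem,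
    (IsLocalization.mk'_one _ _).symm⟩

lemma pow_mem_locPart {S : Submonoid A} {d : D} {y : Localization S}
    (hy : y ∈ locPart 𝒜 𝒜 S d) (n : ℕ) : y ^ n ∈ locPart 𝒜 𝒜 S (n • d) := by
  induction n with
  | zero => simpa using algebraMap_mem_locPart 𝒜 S (SetLike.GradedOne.one_mem (A := 𝒜))
  | succ n ih => rw [pow_succ, succ_nsmul]; exact mul_mem_locPart 𝒜 ih hy

/-- The inverse of a homogeneous unit of `A_f` is homogeneous. -/
lemma exists_homogeneous_inv {f : A} (hf : SetLike.IsHomogeneousElem 𝒜 f) {e : D}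
    {w : Localization (Submonoid.powers f)} (hw : w ∈ locPart 𝒜 𝒜 (Submonoid.powers f) e)
    (hu : IsUnit w) : ∃ v ∈ locPart 𝒜 𝒜 (Submonoid.powers f) (-e), w * v = 1 := by
  obtain ⟨m, hm⟩ := hf
  obtain ⟨v, hv⟩ := hu.exists_right_inv
  obtain ⟨j, a, s, ha, hs, rfl⟩ := (mem_locPart 𝒜).1 hw
  obtain ⟨b, t, rfl⟩ := IsLocalization.exists_mk'_eq (Submonoid.powers f) v
  rw [← IsLocalization.mk'_mul, IsLocalization.mk'_eq_iff_eq_mul, one_mul,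
    IsLocalization.eq_iff_exists (Submonoid.powers f)] at hv
  obtain ⟨c, hc⟩ := hv
  have hpow (x : Submonoid.powers f) : ∃ i, (x : A) ∈ 𝒜 i := by
    obtain ⟨_, k, rfl⟩ := x
    exact ⟨k • m, SetLike.pow_mem_graded k hm⟩
  obtain ⟨l, ht⟩ := hpow t
  obtain ⟨r, hr⟩ := hpow c
  have key : a * (DirectSum.decompose 𝒜 ((c : A) * b) (-e + (r + l)) : A) = c * (s * t) := by
    rw [← DirectSum.coe_decompose_mul_add_of_left_mem 𝒜 ha, show a * (c * b) = c * (a * b) by ring,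
      hc, Submonoid.coe_mul]
    apply DirectSum.decompose_of_mem_same
    rw [show e + j + (-e + (r + l)) = r + (j + l) by abel]
    exact SetLike.mul_mem_graded hr (SetLike.mul_mem_graded hs ht)
  refine ⟨IsLocalization.mk' _ (DirectSum.decompose 𝒜 ((c : A) * b) (-e + (r + l)) : A) (c * t),
    (mem_locPart 𝒜).2 ⟨r + l, _, _, SetLike.coe_mem _, SetLike.mul_mem_graded hr ht, rfl⟩, ?_⟩
  rw [← IsLocalization.mk'_mul, IsLocalization.mk'_eq_iff_eq_mul, one_mul, key]
  congr 1
  simp only [Submonoid.coe_mul]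
  ring

/-- If `f` is relevant, every degree has a positive multiple which is the degree of a homogeneous
unit of `A_f`. -/
lemma IsRelevant.exists_unit {f : A} (hf : IsRelevant 𝒜 f) (e : D) :
    ∃ n : ℕ, 0 < n ∧ ∃ w ∈ locPart 𝒜 𝒜 (Submonoid.powers f) (n • e),
      ∃ v ∈ locPart 𝒜 𝒜 (Submonoid.powers f) (-(n • e)), w * v = 1 := by
  obtain ⟨hh, hfin⟩ := hf
  refine ⟨_, Nat.pos_of_ne_zero hfin.index_ne_zero, ?_⟩
  have hmem := AddSubgroup.nsmul_index_mem (AddSubgroup.closure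
    {e : D | ∃ w ∈ locPart 𝒜 𝒜 (Submonoid.powers f) e, IsUnit (M := Localization _) w}) e
  refine AddSubgroup.closure_induction (p := fun d _ => ∃ w ∈ locPart 𝒜 𝒜 (Submonoid.powers f) d,
      ∃ v ∈ locPart 𝒜 𝒜 (Submonoid.powers f) (-d), (w * v : Localization _) = 1)
    ?_ ?_ ?_ ?_ hmem
  · rintro d ⟨w, hw, hu⟩
    exact ⟨w, hw, exists_homogeneous_inv 𝒜 hh hw hu⟩
  · have h1 := algebraMap_mem_locPart 𝒜 (Submonoid.powers f) (SetLike.GradedOne.one_mem (A := 𝒜))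
    exact ⟨_, h1, _, by simpa using h1, by simp⟩
  · rintro d d' _ _ ⟨w, hw, v, hv, h⟩ ⟨w', hw', v', hv', h'⟩
    refine ⟨_, mul_mem_locPart 𝒜 hw hw', v * v', ?_, ?_⟩
    · rw [neg_add]; exact mul_mem_locPart 𝒜 hv hv'
    · rw [mul_mul_mul_comm, h, h', one_mul]
  · rintro d _ ⟨w, hw, v, hv, h⟩
    exact ⟨v, hv, w, by rwa [neg_neg], by rwa [mul_comm]⟩

section
variable {𝒜}

lemma Point.mem_compl {x : Point 𝒜} {a : A} :
    a ∈ x.compl ↔ SetLike.IsHomogeneousElem 𝒜 a ∧ a ∉ x.ideal := Iff.rfl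

lemma Point.powers_le {x : Point 𝒜} {f : A} (hf : SetLike.IsHomogeneousElem 𝒜 f)
    (hx : f ∉ x.ideal) : Submonoid.powers f ≤ x.compl :=
  Submonoid.powers_le.2 ⟨hf, hx⟩

/-- A homogeneous fraction is a unit iff its numerator is outside the ideal. -/
lemma Point.isUnit_mk'_iff (x : Point 𝒜) {a : A} (ha : SetLike.IsHomogeneousElem 𝒜 a)
    (s : x.compl) : IsUnit (IsLocalization.mk' (Localization x.compl) a s) ↔ a ∉ x.ideal := by
  constructor
  · intro h hax
    obtain ⟨v, hv⟩ := h.exists_right_inv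
    obtain ⟨b, t, rfl⟩ := IsLocalization.exists_mk'_eq x.compl v
    rw [← IsLocalization.mk'_mul, IsLocalization.mk'_eq_iff_eq_mul, one_mul,
      IsLocalization.eq_iff_exists x.compl] at hv
    obtain ⟨c, hc⟩ := hv
    refine (c * (s * t)).2.2 ?_
    rw [Submonoid.coe_mul, ← hc]
    exact x.ideal.toIdeal.mul_mem_left _ (x.ideal.toIdeal.mul_mem_right _ hax)
  · intro h
    have hac : a ∈ x.compl := ⟨ha, h⟩
    exact IsUnit.of_mul_eq_one (IsLocalization.mk' (Localization x.compl) (s : A) ⟨a, hac⟩)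
      (IsLocalization.mk'_mul_mk'_eq_one' (S := Localization x.compl) a s hac)

lemma Point.isUnit_algebraMap_iff (x : Point 𝒜) {a : A} (ha : SetLike.IsHomogeneousElem 𝒜 a) :
    IsUnit (algebraMap A (Localization x.compl) a) ↔ a ∉ x.ideal := by
  rw [← IsLocalization.mk'_one (M := x.compl), x.isUnit_mk'_iff ha]

lemma Point.isUnit_degZero_iff (x : Point 𝒜) (z : degZero 𝒜 x.compl) :
    IsUnit z ↔ IsUnit (z : Localization x.compl) := by
  refine ⟨fun h => h.map (degZero 𝒜 x.compl).subtype, fun h => ?_⟩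
  obtain ⟨z, hz⟩ := z
  obtain ⟨j, a, s, ha, hs, rfl⟩ := (mem_locPart 𝒜).1 ((mem_degZero 𝒜).1 hz)
  have hax := (x.isUnit_mk'_iff ⟨_, ha⟩ s).1 h
  rw [zero_add] at ha
  have hac : a ∈ x.compl := ⟨⟨j, ha⟩, hax⟩
  refine IsUnit.of_mul_eq_one ⟨IsLocalization.mk' (Localization x.compl) (s : A) ⟨a, hac⟩,
    (mem_locPart 𝒜).2 ⟨j, _, _, by simpa using hs, ha, rfl⟩⟩ (Subtype.ext ?_)
  exact IsLocalization.mk'_mul_mk'_eq_one' (S := Localization x.compl) a s hac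

instance (x : Point 𝒜) : IsLocalRing (degZero 𝒜 x.compl) := by
  have hnt : Nontrivial (degZero 𝒜 x.compl) := by
    refine ⟨0, 1, fun h => ?_⟩
    have h0 : IsUnit ((0 : degZero 𝒜 x.compl) : Localization x.compl) := by
      rw [h]; exact isUnit_one
    rw [Subring.coe_zero, ← map_zero (algebraMap A _),
      x.isUnit_algebraMap_iff ⟨0, zero_mem _⟩] at h0
    exact h0 (zero_mem _)
  refine IsLocalRing.of_nonunits_add fun y z hy hz => ?_
  rw [mem_nonunits_iff, x.isUnit_degZero_iff] at *
  obtain ⟨y, hy'⟩ := y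
  obtain ⟨z, hz'⟩ := z
  obtain ⟨i, a, s, ha, hs, rfl⟩ := (mem_locPart 𝒜).1 ((mem_degZero 𝒜).1 hy')
  obtain ⟨j, b, t, hb, ht, rfl⟩ := (mem_locPart 𝒜).1 ((mem_degZero 𝒜).1 hz')
  rw [x.isUnit_mk'_iff ⟨_, ha⟩, not_not] at hy
  rw [x.isUnit_mk'_iff ⟨_, hb⟩, not_not] at hz
  rw [Subring.coe_add, ← IsLocalization.mk'_add, x.isUnit_mk'_iff, not_not]
  · exact add_mem (x.ideal.toIdeal.mul_mem_right _ hy) (x.ideal.toIdeal.mul_mem_right _ hz)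
  · rw [zero_add] at ha hb
    refine ⟨i + j, add_mem (SetLike.mul_mem_graded ha ht) ?_⟩
    rw [add_comm]; exact SetLike.mul_mem_graded hb hs

end

/-- The canonical map `S⁻¹A → T⁻¹A` for `S ≤ T`. -/
def locMap {S T : Submonoid A} (h : S ≤ T) : Localization S →+* Localization T :=
  IsLocalization.map (Localization T) (RingHom.id A) (M := S) (T := T) h

lemma locMap_mk' {S T : Submonoid A} (h : S ≤ T) (a : A) (s : S) :
    locMap h (IsLocalization.mk' (Localization S) a s) =
      IsLocalization.mk' (Localization T) a ⟨s, h s.2⟩ :=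
  IsLocalization.map_mk' _ _ _

lemma locMap_algebraMap {S T : Submonoid A} (h : S ≤ T) (a : A) :
    locMap h (algebraMap A (Localization S) a) = algebraMap A (Localization T) a :=
  IsLocalization.map_eq _ _

lemma locMap_mem {S T : Submonoid A} (h : S ≤ T) {e : D} {z : Localization S}
    (hz : z ∈ locPart 𝒜 𝒜 S e) : locMap h z ∈ locPart 𝒜 𝒜 T e := by
  obtain ⟨j, a, s, ha, hs, rfl⟩ := (mem_locPart 𝒜).1 hz
  exact (mem_locPart 𝒜).2 ⟨j, a, ⟨s, h s.2⟩, ha, hs, locMap_mk' h a s⟩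

/-- The induced map on degree-zero parts. -/
def degMap {S T : Submonoid A} (h : S ≤ T) : degZero 𝒜 S →+* degZero 𝒜 T :=
  ((locMap h).comp (degZero 𝒜 S).subtype).codRestrict (degZero 𝒜 T) fun z => locMap_mem 𝒜 h z.2

lemma coe_degMap {S T : Submonoid A} (h : S ≤ T) (z : degZero 𝒜 S) :
    (degMap 𝒜 h z : Localization T) = locMap h z := rfl

lemma exists_mul_eq_of_locMap_eq {S T : Submonoid A} (h : S ≤ T) {y z : Localization S}
    (hyz : locMap h y = locMap h z) :
    ∃ c ∈ T, algebraMap A (Localization S) c * y = algebraMap A (Localization S) c * z := by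
  obtain ⟨a, s, rfl⟩ := IsLocalization.exists_mk'_eq S y
  obtain ⟨b, t, rfl⟩ := IsLocalization.exists_mk'_eq S z
  rw [locMap_mk', locMap_mk', IsLocalization.mk'_eq_iff_eq, IsLocalization.eq_iff_exists T] at hyz
  obtain ⟨c, hc⟩ := hyz
  refine ⟨c, c.2, ?_⟩
  rw [← IsLocalization.mk'_one (M := S), ← IsLocalization.mk'_mul, ← IsLocalization.mk'_mul,
    IsLocalization.mk'_eq_iff_eq]
  congr 1
  simp only [one_mul]
  linear_combination hc

section
variable {𝒜}
variable {f : A} (hf : IsRelevant 𝒜 f)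

/-- The prime of `A_(f)` attached to a point of `D_+(f)`. -/
def toPrime {f : A} (hf : IsRelevant 𝒜 f) (x : Point 𝒜) (hx : f ∉ x.ideal) :
    PrimeSpectrum (degZero 𝒜 (Submonoid.powers f)) :=
  PrimeSpectrum.comap (degMap 𝒜 (Point.powers_le hf.1 hx))
    (IsLocalRing.closedPoint (degZero 𝒜 x.compl))

lemma notMem_toPrime_iff {x : Point 𝒜} {hx : f ∉ x.ideal}
    {z : degZero 𝒜 (Submonoid.powers f)} :
    z ∉ (toPrime hf x hx).asIdeal ↔
      IsUnit (locMap (Point.powers_le hf.1 hx) (z : Localization (Submonoid.powers f))) := by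
  rw [← coe_degMap 𝒜, ← x.isUnit_degZero_iff]
  change ¬ (_ ∈ IsLocalRing.maximalIdeal _) ↔ _
  rw [IsLocalRing.mem_maximalIdeal, mem_nonunits_iff, not_not]

/-- For homogeneous `a`, some `aⁿ v ∈ A_(f)` with `v` a unit of `A_f` detects `a ∉ x`. -/
lemma exists_detect {a : A} (ha : SetLike.IsHomogeneousElem 𝒜 a) :
    ∃ n : ℕ, 0 < n ∧ ∃ w v : Localization (Submonoid.powers f), w * v = 1 ∧
      ∃ z : degZero 𝒜 (Submonoid.powers f), (z : Localization _) = algebraMap A _ a ^ n * v ∧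
      (∃ e, a ∈ 𝒜 e ∧ v ∈ locPart 𝒜 𝒜 (Submonoid.powers f) (-(n • e))) ∧
      ∀ (x : Point 𝒜) (hx : f ∉ x.ideal), z ∉ (toPrime hf x hx).asIdeal ↔ a ∉ x.ideal := by
  obtain ⟨e, he⟩ := ha
  obtain ⟨n, hn, w, hw, v, hv, h⟩ := hf.exists_unit 𝒜 e
  refine ⟨n, hn, w, v, h, ⟨algebraMap A _ a ^ n * v, ?_⟩, rfl, ⟨e, he, hv⟩, fun x hx => ?_⟩
  · have := mul_mem_locPart 𝒜 (pow_mem_locPart 𝒜 (algebraMap_mem_locPart 𝒜 _ he) n) hv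
    rwa [add_neg_cancel] at this
  · rw [notMem_toPrime_iff, map_mul, map_pow, locMap_algebraMap, ← x.isUnit_algebraMap_iff ⟨e, he⟩,
      IsUnit.mul_iff, isUnit_pow_iff hn.ne', and_iff_left]
    exact (IsUnit.of_mul_eq_one w (by rwa [mul_comm])).map _

lemma toPrime_injective {x y : Point 𝒜} (hx : f ∉ x.ideal) (hy : f ∉ y.ideal)
    (h : toPrime hf x hx = toPrime hf y hy) : x = y := by
  refine Point.ext (HomogeneousIdeal.ext' fun i a ha => ?_)
  obtain ⟨n, -, w, v, -, z, -, -, hz⟩ := exists_detect hf ⟨i, ha⟩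
  rw [← not_iff_not]
  have h1 := hz x hx
  rw [h] at h1
  exact h1.symm.trans (hz y hy)

/-- A prime `q` of `A_(f)`, as a set of elements of `A_f`. -/
def primeSet (q : PrimeSpectrum (degZero 𝒜 (Submonoid.powers f))) :
    AddSubgroup (Localization (Submonoid.powers f)) :=
  q.asIdeal.toAddSubgroup.map (degZero 𝒜 (Submonoid.powers f)).subtype.toAddMonoidHom

lemma coe_mem_primeSet (q : PrimeSpectrum (degZero 𝒜 (Submonoid.powers f)))
    (z : degZero 𝒜 (Submonoid.powers f)) :
    (z : Localization (Submonoid.powers f)) ∈ primeSet q ↔ z ∈ q.asIdeal := by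
  constructor
  · rintro ⟨y, hy, h⟩
    rwa [← Subtype.ext h]
  · exact fun h => ⟨z, h, rfl⟩

/-- The ideal of `A` attached to a prime `q` of `A_(f)`. -/
def idealOf (q : PrimeSpectrum (degZero 𝒜 (Submonoid.powers f))) : Ideal A where
  carrier := {a | ∀ (i : D), ∀ v ∈ locPart 𝒜 𝒜 (Submonoid.powers f) (-i),
    algebraMap A (Localization (Submonoid.powers f)) (DirectSum.decompose 𝒜 a i : A) * v ∈
      primeSet q}
  zero_mem' i v _ := by simp
  add_mem' {a b} ha hb i v hv := by
    rw [DirectSum.decompose_add, DirectSum.add_apply, AddSubgroup.coe_add, map_add, add_mul]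
    exact add_mem (ha i v hv) (hb i v hv)
  smul_mem' c a ha := by
    induction c using DirectSum.Decomposition.inductionOn 𝒜 with
    | zero => intro i v _; simp
    | @homogeneous j c =>
      intro i v hv
      have h := DirectSum.coe_decompose_mul_add_of_left_mem 𝒜 (j := i - j) (b := a) c.2
      rw [add_sub_cancel] at h
      rw [smul_eq_mul, h, map_mul, mul_comm (algebraMap A _ (c : A)), mul_assoc]
      refine ha _ _ ?_
      rw [show -(i - j) = j + -i by abel]
      exact mul_mem_locPart 𝒜 (algebraMap_mem_locPart 𝒜 _ c.2) hv
    | add c d hc hd =>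
      intro i v hv
      rw [add_smul, DirectSum.decompose_add, DirectSum.add_apply, AddSubgroup.coe_add, map_add,
        add_mul]
      exact add_mem (hc i v hv) (hd i v hv)

lemma mem_idealOf (q : PrimeSpectrum (degZero 𝒜 (Submonoid.powers f))) {i : D} {a : A}
    (ha : a ∈ 𝒜 i) : a ∈ idealOf q ↔ ∀ v ∈ locPart 𝒜 𝒜 (Submonoid.powers f) (-i),
      algebraMap A (Localization (Submonoid.powers f)) a * v ∈ primeSet q := by
  constructor
  · intro h v hv
    have := h i v hv
    rwa [DirectSum.decompose_of_mem_same 𝒜 ha] at this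
  · intro h j v hv
    by_cases hij : i = j
    · subst hij
      rw [DirectSum.decompose_of_mem_same 𝒜 ha]
      exact h v hv
    · rw [DirectSum.decompose_of_mem_ne 𝒜 ha hij]
      simp

lemma mk'_one_mem_locPart {j : D} (s : Submonoid.powers f) (hs : (s : A) ∈ 𝒜 j) :
    IsLocalization.mk' (Localization (Submonoid.powers f)) (1 : A) s ∈
      locPart 𝒜 𝒜 (Submonoid.powers f) (-j) :=
  (mem_locPart 𝒜).2 ⟨j, 1, s, by simpa using SetLike.GradedOne.one_mem (A := 𝒜), hs, rfl⟩

/-- The point of `D_+(f)` attached to a prime of `A_(f)`. -/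
def ofPrime (hf : IsRelevant 𝒜 f) (q : PrimeSpectrum (degZero 𝒜 (Submonoid.powers f))) :
    {x : Point 𝒜 // f ∉ x.ideal} :=
  have hfq : f ∉ idealOf q := by
    obtain ⟨m, hm⟩ := hf.1
    intro h
    have h1 := (mem_idealOf q hm).1 h _
      (mk'_one_mem_locPart (⟨f, Submonoid.mem_powers f⟩ : Submonoid.powers f) hm)
    rw [IsLocalization.mul_mk'_eq_mk'_of_mul, mul_one, IsLocalization.mk'_self] at h1
    exact q.isPrime.one_notMem ((coe_mem_primeSet q 1).1 h1)
  ⟨{  ideal := ⟨idealOf q, fun i a ha => by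
        rw [mem_idealOf q (SetLike.coe_mem _)]
        exact ha i⟩
      one_notMem := fun h => hfq (by
        have h' : idealOf q = ⊤ := (Ideal.eq_top_iff_one _).2 h
        rw [h']; exact Submodule.mem_top)
      mem_or_mem := by
        rintro a b ⟨i, ha⟩ ⟨j, hb⟩ hab
        by_contra! h
        obtain ⟨h1, h2⟩ := h
        change a ∉ idealOf q at h1
        change b ∉ idealOf q at h2
        change a * b ∈ idealOf q at hab
        rw [mem_idealOf q ha] at h1
        rw [mem_idealOf q hb] at h2
        push Not at h1 h2
        obtain ⟨v, hv, h1⟩ := h1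
        obtain ⟨w, hw, h2⟩ := h2
        have h3 := (mem_idealOf q (SetLike.mul_mem_graded ha hb)).1 hab (v * w) (by
          rw [neg_add]; exact mul_mem_locPart 𝒜 hv hw)
        rw [map_mul, mul_mul_mul_comm] at h3
        have m1 := mul_mem_locPart 𝒜 (algebraMap_mem_locPart 𝒜 (Submonoid.powers f) ha) hv
        have m2 := mul_mem_locPart 𝒜 (algebraMap_mem_locPart 𝒜 (Submonoid.powers f) hb) hw
        rw [add_neg_cancel] at m1 m2
        have h4 := (coe_mem_primeSet q (⟨_, m1⟩ * ⟨_, m2⟩)).1 h3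
        rcases q.isPrime.mem_or_mem h4 with h | h
        · exact h1 ((coe_mem_primeSet q _).2 h)
        · exact h2 ((coe_mem_primeSet q _).2 h)
      exists_relevant := ⟨f, hf, hfq⟩ }, hfq⟩

lemma mem_ofPrime (q : PrimeSpectrum (degZero 𝒜 (Submonoid.powers f))) {a : A} :
    a ∈ (ofPrime hf q).1.ideal ↔ a ∈ idealOf q := Iff.rfl

lemma toPrime_ofPrime (q : PrimeSpectrum (degZero 𝒜 (Submonoid.powers f))) :
    toPrime hf (ofPrime hf q).1 (ofPrime hf q).2 = q := by
  refine PrimeSpectrum.ext (Ideal.ext fun z => ?_)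
  rw [← not_iff_not, notMem_toPrime_iff]
  obtain ⟨z, hz⟩ := z
  obtain ⟨j, a, s, ha, hs, rfl⟩ := (mem_locPart 𝒜).1 ((mem_degZero 𝒜).1 hz)
  rw [locMap_mk', Point.isUnit_mk'_iff _ ⟨_, ha⟩, mem_ofPrime, mem_idealOf q ha, not_iff_not,
    ← coe_mem_primeSet]
  rw [zero_add] at ha ⊢
  have e (v : Localization (Submonoid.powers f)) : algebraMap A _ a * v =
      IsLocalization.mk' (Localization (Submonoid.powers f)) a s * (algebraMap A _ (s : A) * v) := by
    rw [← mul_assoc, IsLocalization.mk'_spec]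
  constructor
  · intro h
    have h1 := h _ (mk'_one_mem_locPart s hs)
    rwa [IsLocalization.mul_mk'_eq_mk'_of_mul, mul_one] at h1
  · intro h v hv
    have m1 := mul_mem_locPart 𝒜 (algebraMap_mem_locPart 𝒜 (Submonoid.powers f) hs) hv
    rw [add_neg_cancel] at m1
    rw [e]
    exact (coe_mem_primeSet q (⟨_, hz⟩ * ⟨_, m1⟩)).2
      (q.asIdeal.mul_mem_right _ ((coe_mem_primeSet q _).1 h))

/-- The stalk `A_(x)` is the localization of `A_(f)` at the prime attached to `x`. -/
lemma isLocalization_toPrime (x : Point 𝒜) (hx : f ∉ x.ideal) :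
    @IsLocalization _ _ (toPrime hf x hx).asIdeal.primeCompl (degZero 𝒜 x.compl) _
      (degMap 𝒜 (Point.powers_le hf.1 hx)).toAlgebra := by
  let := (degMap 𝒜 (Point.powers_le hf.1 hx)).toAlgebra
  constructor; constructor
  · rintro ⟨z, hz⟩
    rw [RingHom.algebraMap_toAlgebra, x.isUnit_degZero_iff, coe_degMap]
    exact (notMem_toPrime_iff hf).1 hz
  · rintro ⟨w, hw⟩
    obtain ⟨j, a, s, ha, hs, rfl⟩ := (mem_locPart 𝒜).1 ((mem_degZero 𝒜).1 hw)
    rw [zero_add] at ha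
    by_cases hs0 : (s : A) = 0
    · exact absurd (hs0 ▸ zero_mem x.ideal.toIdeal) s.2.2
    obtain ⟨n, hn, w, v, hwv, z, hz, ⟨e, he, hv⟩, hd⟩ := exists_detect hf s.2.1
    obtain rfl : j = e := DirectSum.degree_eq_of_mem_mem 𝒜 hs he hs0
    obtain ⟨n, rfl⟩ : ∃ k, n = k + 1 := ⟨n - 1, by omega⟩
    have hnum : algebraMap A (Localization (Submonoid.powers f)) (a * s ^ n) * v ∈
        degZero 𝒜 (Submonoid.powers f) := by
      have h := mul_mem_locPart 𝒜 (algebraMap_mem_locPart 𝒜 (Submonoid.powers f)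
        (SetLike.mul_mem_graded ha (SetLike.pow_mem_graded n hs))) hv
      rwa [show j + n • j + -((n + 1) • j) = 0 by rw [succ_nsmul]; abel] at h
    refine ⟨⟨⟨_, hnum⟩, ⟨z, (hd x hx).2 s.2.2⟩⟩, Subtype.ext ?_⟩
    rw [RingHom.algebraMap_toAlgebra, Subring.coe_mul, coe_degMap, coe_degMap, hz]
    simp only [map_mul, map_pow, locMap_algebraMap]
    rw [pow_succ', ← mul_assoc, ← mul_assoc, IsLocalization.mk'_spec]
  · rintro ⟨y, hy⟩ ⟨z, hz⟩ h
    rw [RingHom.algebraMap_toAlgebra, Subtype.ext_iff, coe_degMap, coe_degMap] at h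
    obtain ⟨c, hc, hcy⟩ := exists_mul_eq_of_locMap_eq _ h
    obtain ⟨n, hn, w, v, hwv, t, ht, -, hd⟩ := exists_detect hf hc.1
    obtain ⟨n, rfl⟩ : ∃ k, n = k + 1 := ⟨n - 1, by omega⟩
    refine ⟨⟨t, (hd x hx).2 hc.2⟩, Subtype.ext ?_⟩
    simp only [Subring.coe_mul, ht]
    linear_combination (algebraMap A _ c ^ n * v) * hcy
end

lemma isOpen_basicSet {f : A} (hf : SetLike.IsHomogeneousElem 𝒜 f) : IsOpen (basicSet 𝒜 f) :=
  TopologicalSpace.isOpen_generateFrom_of_mem ⟨f, hf, rfl⟩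

/-- `D_+(f)` as an open set. -/
def basicOpen {f : A} (hf : SetLike.IsHomogeneousElem 𝒜 f) : Opens (top 𝒜) :=
  ⟨basicSet 𝒜 f, isOpen_basicSet 𝒜 hf⟩

variable {𝒜} in
lemma mem_basicOpen {f : A} (hf : SetLike.IsHomogeneousElem 𝒜 f) {x : Point 𝒜} :
    (show top 𝒜 from x) ∈ basicOpen 𝒜 hf ↔ f ∉ x.ideal := Iff.rfl

/-- The value of a section at a point lies in the degree-zero part of the localization. -/
lemma apply_mem_degZero {U : Opens (top 𝒜)} (s : sectionsRing 𝒜 U) (x : U) :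
    s.1 x ∈ degZero 𝒜 (Point.compl (𝒜 := 𝒜) x.1) := by
  obtain ⟨V, hV, iV, j, m, a, hm, ha, h⟩ := s.2 x
  obtain ⟨h1, h2⟩ := h ⟨x.1, hV⟩
  exact ⟨j, m, ⟨a, h1⟩, by simpa using hm, ha, h2⟩

/-- Evaluation of sections at a point. -/
def evalAt (U : Opens (top 𝒜)) (x : top 𝒜) (hx : x ∈ U) :
    (structureSheaf 𝒜).presheaf.obj (op U) ⟶ CommRingCat.of (degZero 𝒜 (Point.compl (𝒜 := 𝒜) x)) :=
  CommRingCat.ofHom <|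
    ((Pi.evalRingHom (fun y : U => Localization (Point.compl (𝒜 := 𝒜) y.1)) ⟨x, hx⟩).comp
      (sectionsRing 𝒜 U).subtype).codRestrict _ fun s => apply_mem_degZero 𝒜 s ⟨x, hx⟩

/-- The map from the stalk at `x` to `A_(x)`. -/
def stalkToFiber (x : top 𝒜) :
    (structureSheaf 𝒜).presheaf.stalk x ⟶ CommRingCat.of (degZero 𝒜 (Point.compl (𝒜 := 𝒜) x)) :=
  Limits.colimit.desc ((OpenNhds.inclusion x).op ⋙ (structureSheaf 𝒜).presheaf)
    { pt := _
      ι := { app := fun U => evalAt 𝒜 ((OpenNhds.inclusion _).obj U.unop) x U.unop.2 } }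

lemma germ_stalkToFiber (U : Opens (top 𝒜)) (x : top 𝒜) (hx : x ∈ U) :
    (structureSheaf 𝒜).presheaf.germ U x hx ≫ stalkToFiber 𝒜 x = evalAt 𝒜 U x hx :=
  Limits.colimit.ι_desc _ _

lemma stalkToFiber_germ (U : Opens (top 𝒜)) (x : top 𝒜) (hx : x ∈ U)
    (s : (structureSheaf 𝒜).presheaf.obj (op U)) :
    stalkToFiber 𝒜 x ((structureSheaf 𝒜).presheaf.germ U x hx s) = evalAt 𝒜 U x hx s :=
  congr($(germ_stalkToFiber 𝒜 U x hx) s)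

lemma stalkToFiber_bijective (x : top 𝒜) : Function.Bijective (stalkToFiber 𝒜 x) := by
  constructor
  · intro s t h
    obtain ⟨U, hU, s, rfl⟩ := (structureSheaf 𝒜).presheaf.exists_germ_eq s
    obtain ⟨V, hV, t, rfl⟩ := (structureSheaf 𝒜).presheaf.exists_germ_eq t
    rw [stalkToFiber_germ, stalkToFiber_germ] at h
    have h' : s.1 ⟨x, hU⟩ = t.1 ⟨x, hV⟩ := congrArg Subtype.val h
    obtain ⟨U', hU', iU, i, m, a, hm, ha, hs⟩ := s.2 ⟨x, hU⟩
    obtain ⟨V', hV', iV, j, n, b, hn, hb, ht⟩ := t.2 ⟨x, hV⟩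
    obtain ⟨ha', es⟩ := hs ⟨x, hU'⟩
    obtain ⟨hb', et⟩ := ht ⟨x, hV'⟩
    have e : LocalizedModule.mk m ⟨a, ha'⟩ = LocalizedModule.mk n ⟨b, hb'⟩ :=
      es.symm.trans (h'.trans et)
    obtain ⟨⟨c, hc⟩, e⟩ := LocalizedModule.mk_eq.1 e
    refine TopCat.Presheaf.germ_ext _ (U' ⊓ V' ⊓ basicOpen 𝒜 hc.1) ⟨⟨hU', hV'⟩, hc.2⟩
      (homOfLE (inf_le_left.trans inf_le_left) ≫ iU) (homOfLE (inf_le_left.trans inf_le_right) ≫ iV)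
      ?_
    refine Subtype.ext (funext fun y => ?_)
    obtain ⟨ha'', es⟩ := hs ⟨y.1, y.2.1.1⟩
    obtain ⟨hb'', et⟩ := ht ⟨y.1, y.2.1.2⟩
    refine es.trans (Eq.trans ?_ et.symm)
    exact LocalizedModule.mk_eq.2 ⟨⟨c, hc.1, y.2.2⟩, e⟩
  · rintro ⟨w, hw⟩
    obtain ⟨j, m, s, hm, hs, rfl⟩ := hw
    rw [zero_add] at hm
    refine ⟨(structureSheaf 𝒜).presheaf.germ (basicOpen 𝒜 s.2.1) x s.2.2
      ⟨fun y => LocalizedModule.mk m ⟨s, s.2.1, y.2⟩, fun y => ⟨_, y.2, 𝟙 _, j, m, s, hm, hs,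
        fun z => ⟨⟨s.2.1, z.2⟩, rfl⟩⟩⟩, ?_⟩
    exact stalkToFiber_germ 𝒜 _ x _ _

/-- The stalk of the structure sheaf at `x` is `A_(x)`. -/
def stalkIso (x : top 𝒜) :
    (structureSheaf 𝒜).presheaf.stalk x ≅ CommRingCat.of (degZero 𝒜 (Point.compl (𝒜 := 𝒜) x)) :=
  (RingEquiv.ofBijective (stalkToFiber 𝒜 x).hom (stalkToFiber_bijective 𝒜 x)).toCommRingCatIso

lemma stalkIso_hom (x : top 𝒜) : (stalkIso 𝒜 x).hom = stalkToFiber 𝒜 x := rfl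

/-- The multihomogeneous space as a locally ringed space. -/
def toLocallyRingedSpace : LocallyRingedSpace.{u} where
  carrier := top 𝒜
  presheaf := (structureSheaf 𝒜).presheaf
  IsSheaf := (structureSheaf 𝒜).property
  isLocalRing x := @RingEquiv.isLocalRing _ _ _
    (inferInstanceAs (IsLocalRing (degZero 𝒜 (Point.compl (𝒜 := 𝒜) x)))) _
    (stalkIso 𝒜 x).symm.commRingCatIsoToRingEquiv

/-- The stalk of `X` at a point `x` is `A_(x)`. -/
def lrsStalkIso (x : top 𝒜) : (toLocallyRingedSpace 𝒜).presheaf.stalk x ≅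
    CommRingCat.of (degZero 𝒜 (Point.compl (𝒜 := 𝒜) x)) := stalkIso 𝒜 x

section
variable {𝒜} {f : A} (hf : IsRelevant 𝒜 f)

/-- The restriction of `X` to `D_+(f)`. -/
abbrev chart : LocallyRingedSpace.{u} :=
  (toLocallyRingedSpace 𝒜).restrict (basicOpen 𝒜 hf.1).isOpenEmbedding

/-- The stalk of `D_+(f)` at a point. -/
def chartStalkIso (x : chart hf) : CommRingCat.of (degZero 𝒜 (Point.compl (𝒜 := 𝒜) x.1)) ≅
    (chart hf).presheaf.stalk x :=
  (lrsStalkIso 𝒜 x.1).symm ≪≫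
    ((toLocallyRingedSpace 𝒜).restrictStalkIso (basicOpen 𝒜 hf.1).isOpenEmbedding x).symm

/-- The section of the structure sheaf on `D_+(f)` given by an element of `A_(f)`. -/
def awaySection (z : degZero 𝒜 (Submonoid.powers f)) : sectionsRing 𝒜 (basicOpen 𝒜 hf.1) :=
  ⟨fun y => locMap (Point.powers_le (x := y.1) hf.1 y.2) z.1, fun y => by
    obtain ⟨j, m, s, hm, hs, h⟩ := (mem_locPart 𝒜).1 ((mem_degZero 𝒜).1 z.2)
    refine ⟨_, y.2, 𝟙 _, j, m, s, by simpa using hm, hs,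
      fun w => ⟨Point.powers_le (x := w.1) hf.1 w.2 s.2, ?_⟩⟩
    change locMap _ z.1 = Localization.mk _ _
    rw [h, locMap_mk', Localization.mk_eq_mk'_apply]⟩

/-- The ring map `A_(f) → Γ(D_+(f), O)`. -/
def awayToSection : CommRingCat.of (degZero 𝒜 (Submonoid.powers f)) ⟶
    (structureSheaf 𝒜).presheaf.obj (op (basicOpen 𝒜 hf.1)) :=
  CommRingCat.ofHom (S := sectionsRing 𝒜 (basicOpen 𝒜 hf.1))
    { toFun := awaySection hf
      map_one' := Subtype.ext (funext fun _ => map_one _)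
      map_mul' _ _ := Subtype.ext (funext fun _ => map_mul _ _ _)
      map_zero' := Subtype.ext (funext fun _ => map_zero _)
      map_add' _ _ := Subtype.ext (funext fun _ => map_add _ _ _) }

lemma awayToSection_germ (x : top 𝒜) (hx : x ∈ basicOpen 𝒜 hf.1) :
    awayToSection hf ≫ (structureSheaf 𝒜).presheaf.germ _ x hx =
      CommRingCat.ofHom (degMap 𝒜 (Point.powers_le (x := x) hf.1 hx)) ≫ (stalkIso 𝒜 x).inv := by
  rw [Iso.eq_comp_inv, Category.assoc, stalkIso_hom, germ_stalkToFiber]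
  rfl

/-- The ring map from `A_(f)` to the global sections of the restriction to `D_+(f)`. -/
def awayToΓ : CommRingCat.of (degZero 𝒜 (Submonoid.powers f)) ⟶
    (chart hf).presheaf.obj (op ⊤) :=
  awayToSection hf ≫ (structureSheaf 𝒜).presheaf.map
    (homOfLE (Opens.isOpenEmbedding_obj_top _).le).op

lemma awayToΓ_Γgerm (x : chart hf) :
    awayToΓ hf ≫ (chart hf).presheaf.Γgerm x =
      CommRingCat.ofHom (degMap 𝒜 (Point.powers_le (x := x.1) hf.1 x.2)) ≫
        (chartStalkIso hf x).hom := by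
  have h1 := LocallyRingedSpace.restrictStalkIso_hom_eq_germ (toLocallyRingedSpace 𝒜)
    (basicOpen 𝒜 hf.1).isOpenEmbedding ⊤ x trivial
  have h2 : awayToΓ hf ≫ (toLocallyRingedSpace 𝒜).presheaf.germ _ x.1 ⟨x, trivial, rfl⟩ =
      CommRingCat.ofHom (degMap 𝒜 (Point.powers_le (x := x.1) hf.1 x.2)) ≫
        (lrsStalkIso 𝒜 x.1).inv :=
    Eq.trans ((Category.assoc _ _ _).trans congr(awayToSection hf ≫
      $(TopCat.Presheaf.germ_res (structureSheaf 𝒜).presheaf _ x.1 _)))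
      (awayToSection_germ hf x.1 x.2)
  have h3 : (awayToΓ hf ≫ (chart hf).presheaf.Γgerm x) ≫
      ((toLocallyRingedSpace 𝒜).restrictStalkIso (basicOpen 𝒜 hf.1).isOpenEmbedding x).hom =
      CommRingCat.ofHom (degMap 𝒜 (Point.powers_le (x := x.1) hf.1 x.2)) ≫
        (lrsStalkIso 𝒜 x.1).inv :=
    (Category.assoc _ _ _).trans (congr(awayToΓ hf ≫ $h1).trans h2)
  exact ((Iso.eq_comp_inv _).2 h3).trans (Category.assoc _ _ _)

/-- The morphism `D_+(f) → Spec A_(f)`. -/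
def toSpec : chart hf ⟶ Spec.locallyRingedSpaceObj (.of (degZero 𝒜 (Submonoid.powers f))) :=
  ΓSpec.locallyRingedSpaceAdjunction.homEquiv (chart hf)
    (op (CommRingCat.of (degZero 𝒜 (Submonoid.powers f)))) (awayToΓ hf).op

lemma toSpec_base_apply (x : chart hf) : (toSpec hf).base x = toPrime hf x.1 x.2 := by
  change PrimeSpectrum.comap (awayToΓ hf ≫ (chart hf).presheaf.Γgerm x).hom
        (IsLocalRing.closedPoint ((chart hf).presheaf.stalk x)) = _
  rw [awayToΓ_Γgerm, CommRingCat.hom_comp, PrimeSpectrum.comap_comp]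
  exact congr(PrimeSpectrum.comap _ $(@IsLocalRing.comap_closedPoint
    (degZero 𝒜 (Point.compl (𝒜 := 𝒜) x.1)) _ _
    ((chart hf).presheaf.stalk x) _ _ _ (isLocalHom_of_isIso (chartStalkIso hf x).hom)))

lemma toSpec_base_bijective : Function.Bijective (toSpec hf).base := by
  constructor
  · intro x y h
    rw [toSpec_base_apply, toSpec_base_apply] at h
    exact Subtype.ext (toPrime_injective hf x.2 y.2 h)
  · intro q
    exact ⟨ofPrime hf q, (toSpec_base_apply hf _).trans (toPrime_ofPrime hf q)⟩

lemma toSpec_base_isInducing : Topology.IsInducing (toSpec hf).base := by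
  refine ⟨le_antisymm (continuous_iff_le_induced.1 (toSpec hf).base.hom.continuous) ?_⟩
  have h : (TopologicalSpace.generateFrom
      {U : Set (Point 𝒜) | ∃ f : A, SetLike.IsHomogeneousElem 𝒜 f ∧ U = basicSet 𝒜 f}).induced
      (Subtype.val : {x : Point 𝒜 // f ∉ x.ideal} → Point 𝒜) = TopologicalSpace.generateFrom _ :=
    induced_generateFrom_eq
  refine (le_generateFrom ?_).trans h.ge
  rintro _ ⟨_, ⟨a, ha, rfl⟩, rfl⟩
  obtain ⟨n, -, w, v, -, z, -, -, hz⟩ := exists_detect hf ha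
  refine ⟨(PrimeSpectrum.basicOpen z).1, (PrimeSpectrum.basicOpen z).2, Set.ext fun x => ?_⟩
  refine Iff.trans ?_ (hz x.1 x.2)
  rw [← toSpec_base_apply hf x]
  exact Iff.rfl

lemma toStalk_stalkMap_toSpec (x : chart hf) :
    StructureSheaf.toStalk (degZero 𝒜 (Submonoid.powers f)) ((toSpec hf).base x) ≫
      (toSpec hf).stalkMap x = awayToΓ hf ≫ (chart hf).presheaf.Γgerm x := by
  have h1 := LocallyRingedSpace.stalkMap_germ (toSpec hf) ⊤ x trivial
  have h2 := ΓSpec.toOpen_comp_locallyRingedSpaceAdjunction_homEquiv_app (X := chart hf)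
    (awayToΓ hf).op (op ⊤)
  have h3 := TopCat.Presheaf.germ_res (chart hf).presheaf (𝟙 (⊤ : Opens (chart hf))) x trivial
  refine (Category.assoc _ _ _).trans (congr(_ ≫ $h1).trans ?_)
  refine (Category.assoc _ _ _).symm.trans (congr($h2 ≫ _).trans ?_)
  exact (Category.assoc _ _ _).trans congr(awayToΓ hf ≫ $h3)

lemma isIso_of_isLocalization {R B : Type u} [CommRing R] [CommRing B] (p q : PrimeSpectrum R)
    (hpq : p = q) (g : (Spec.structureSheaf R).presheaf.stalk p ⟶ CommRingCat.of B) (φ : R →+* B)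
    (hφ : StructureSheaf.toStalk R p ≫ g = CommRingCat.ofHom φ)
    (h : @IsLocalization R _ q.asIdeal.primeCompl B _ φ.toAlgebra) : IsIso g := by
  subst hpq
  let : Algebra R B := φ.toAlgebra
  let e := IsLocalization.algEquiv (R := R) (M := p.asIdeal.primeCompl)
      (S := (Spec.structureSheaf R).presheaf.stalk p) (Q := B)
  have he : g = e.toRingEquiv.toCommRingCatIso.hom := by
    refine CommRingCat.hom_ext <|
      IsLocalization.ringHom_ext (R := R) p.asIdeal.primeCompl
        (S := (Spec.structureSheaf R).presheaf.stalk p) ?_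
    ext a
    exact congr($hφ a).trans (e.commutes a).symm
  rw [he]
  infer_instance

lemma isIso_stalkMap_toSpec (x : chart hf) : IsIso ((toSpec hf).stalkMap x) := by
  have h1 : StructureSheaf.toStalk (degZero 𝒜 (Submonoid.powers f)) ((toSpec hf).base x) ≫
      ((toSpec hf).stalkMap x ≫ (chartStalkIso hf x).inv) =
      CommRingCat.ofHom (degMap 𝒜 (Point.powers_le (x := x.1) hf.1 x.2)) :=
    (Category.assoc _ _ _).symm.trans ((Iso.comp_inv_eq _).2
      ((toStalk_stalkMap_toSpec hf x).trans (awayToΓ_Γgerm hf x)))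
  have h2 := isLocalization_toPrime hf x.1 x.2
  have h3 : IsIso ((toSpec hf).stalkMap x ≫ (chartStalkIso hf x).inv) :=
    isIso_of_isLocalization ((toSpec hf).base x) _ (toSpec_base_apply hf x) _ _ h1 h2
  exact IsIso.of_isIso_comp_right _ (chartStalkIso hf x).inv

lemma isIso_toSpec : IsIso (toSpec hf) := by
  have _ (x) : IsIso ((toSpec hf).stalkMap x) := isIso_stalkMap_toSpec hf x
  have hi := toSpec_base_isInducing hf
  have hb := toSpec_base_bijective hf
  have : LocallyRingedSpace.IsOpenImmersion (toSpec hf) :=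
    LocallyRingedSpace.IsOpenImmersion.of_stalk_iso (toSpec hf)
      ⟨⟨hi, hb.1⟩, by rw [hb.2.range_eq]; exact isOpen_univ⟩
  have : Epi (toSpec hf).base := (TopCat.epi_iff_surjective _).2 hb.2
  exact LocallyRingedSpace.IsOpenImmersion.to_iso _

end

/-- The multihomogeneous space `Proj_MH A` as a scheme: it is the union of the open subschemes
`D_+(f) ≅ Spec A_(f)`, `f` relevant. -/
def ProjMH : Scheme.{u} where
  __ := toLocallyRingedSpace 𝒜
  local_affine x := by
    obtain ⟨f, hf, hx⟩ := Point.exists_relevant (𝒜 := 𝒜) x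
    have := isIso_toSpec hf
    exact ⟨⟨basicOpen 𝒜 hf.1, hx⟩, .of (degZero 𝒜 (Submonoid.powers f)), ⟨@asIso _ _ _ _ (toSpec hf) this⟩⟩


/-- The sheaf of modules `M~` on `X = Proj A` attached to a graded `A`-module `M`: sections over `U`
are the functions `x ↦ s(x) ∈ M_(x)` which are locally of the form `m / a` with `m ∈ M` and `a ∈ A`
homogeneous of the same degree. -/
def tilde : (ProjMH 𝒜).Modules where
  val := modulePresheaf 𝒜 ℳ
  isSheaf := (TopCat.Presheaf.isSheaf_iff_isSheaf_comp (forget AddCommGrpCat) _).2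
    (sheafInType 𝒜 ℳ).2

/-- The grading of the shifted module `A(d)`: the `A`-module `A` with `A(d)_e = A_{e + d}`. -/
def shift (d : D) : D → AddSubgroup A := fun e => 𝒜 (e + d)

instance (d : D) : SetLike.GradedSMul 𝒜 (shift 𝒜 d) where
  smul_mem {i j a b} ha hb := by
    change a * b ∈ 𝒜 (i + j + d)
    rw [add_assoc]
    exact SetLike.mul_mem_graded ha hb

/-- The twisted sheaf `O_X(d) = A(d)~` on `X = Proj A`. -/
def twistedSheaf (d : D) : (ProjMH 𝒜).Modules := tilde 𝒜 (shift 𝒜 d)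

/-- A sheaf of modules on a scheme is a line bundle if it is locally isomorphic to the structure
sheaf. -/
def IsLineBundle {X : Scheme.{u}} (L : X.Modules) : Prop :=
  ∀ x : X, ∃ U : X.Opens, x ∈ U ∧
    Nonempty (L.restrict U.ι ≅ (SheafOfModules.unit U.toScheme.ringCatSheaf : U.toScheme.Modules))

end MultiProj

end

noncomputable section

namespace MultiProj

open CategoryTheory TopologicalSpace Opposite AlgebraicGeometry

/-! ### Degrees in `D_f` and fractions invertible on `D_+(f)` -/

section Divisors

variable {D : Type v} [AddCommGroup D] [DecidableEq D] {A : Type u} [CommRing A]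
variable {𝒜 : D → AddSubgroup A} [GradedRing 𝒜]

/-! The sets `D_+(f)` with `f` relevant cover `X`, so it suffices to trivialize `O_X(d)` on each of
them. The key is a fraction `a / b` of homogeneous elements, of degree `d`, with `a` and `b` outside
`I_p` for every `p` in `D_+(f)`. A homogeneous divisor of a power of `f` vanishes at no point of
`D_+(f)` (`Point.mem_compl_of_dvd_pow`). The degrees of such divisors generate `D_f`, and degrees of
nowhere vanishing fractions are closed under sums and negatives, because fractions can be multiplied
and inverted. Hence every element of `D_f`, in particular `d`, is such a degree
(`exists_fraction_of_mem_divisorDegrees`).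

Given `a / b`, multiplication by `b / a` lowers degrees by `d`. It therefore carries the degree-zero
part of a localization of `A(d)`, which is the degree-`d` part of that localization of `A`, to the
degree-zero part for `A`, and multiplication by `a / b` undoes it. A function that is locally a
fraction stays so after multiplication by one fixed fraction (`fraction_smul_mem_sections`). This
gives linear isomorphisms on sections (`sectionsEquiv`), compatible with restriction, and hence an
isomorphism of sheaves of modules on all of `D_+(f)` (`twistedSheafTrivialization`). -/

lemma Point.mem_compl_of_dvd_pow {x : Point 𝒜} {f a : A} {e : D} {N : ℕ}
    (hf : SetLike.IsHomogeneousElem 𝒜 f) (hx : f ∉ x.ideal) (ha : a ∈ 𝒜 e) (h : a ∣ f ^ N) :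
    a ∈ x.compl :=
  -- If `a` were in the ideal, so would be its multiple `f ^ N`; but the powers of `f` stay in the
  -- multiplicative set of the point.
  ⟨⟨e, ha⟩, fun hax => (pow_mem (Point.powers_le hf hx (Submonoid.mem_powers f)) N).2
    (Ideal.mem_of_dvd x.ideal.toIdeal h hax)⟩

/-- Every element of `D_f` is the degree of a fraction `a / b` of homogeneous elements without
zeros on `D_+(f)`. -/
lemma exists_fraction_of_mem_divisorDegrees {f : A} (hf : SetLike.IsHomogeneousElem 𝒜 f) {d : D}
    (hd : d ∈ divisorDegrees 𝒜 f) :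
    ∃ (i : D) (a b : A), a ∈ 𝒜 (d + i) ∧ b ∈ 𝒜 i ∧
      ∀ x : Point 𝒜, f ∉ x.ideal → a ∈ x.compl ∧ b ∈ x.compl := by
  -- Writing the degree of `a` as `d + i`, with `i` the degree of `b`, expresses `deg a - deg b = d`
  -- even when `a` or `b` is zero and so has no unique degree.
  refine AddSubgroup.closure_induction (p := fun d _ => ∃ (i : D) (a b : A), a ∈ 𝒜 (d + i) ∧
    b ∈ 𝒜 i ∧ ∀ x : Point 𝒜, f ∉ x.ideal → a ∈ x.compl ∧ b ∈ x.compl) ?_ ?_ ?_ ?_ hd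
  · rintro e ⟨a, ha, N, -, h⟩
    exact ⟨0, a, 1, by simpa using ha, SetLike.GradedOne.one_mem,
      fun x hx => ⟨Point.mem_compl_of_dvd_pow hf hx ha h, one_mem _⟩⟩
  · exact ⟨0, 1, 1, by simpa using SetLike.GradedOne.one_mem (A := 𝒜), SetLike.GradedOne.one_mem,
      fun x _ => ⟨one_mem _, one_mem _⟩⟩
  · rintro d e _ _ ⟨i, a, b, ha, hb, h⟩ ⟨j, a₂, b₂, ha₂, hb₂, h₂⟩
    refine ⟨i + j, a * a₂, b * b₂, ?_, SetLike.mul_mem_graded hb hb₂,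
      fun x hx => ⟨mul_mem (h x hx).1 (h₂ x hx).1, mul_mem (h x hx).2 (h₂ x hx).2⟩⟩
    rw [add_add_add_comm]
    exact SetLike.mul_mem_graded ha ha₂
  · rintro d _ ⟨i, a, b, ha, hb, h⟩
    -- Inverting the fraction swaps numerator and denominator, so the new denominator has degree `d
    -- + i` and the new numerator degree `-d + (d + i) = i`.
    exact ⟨d + i, b, a, by simpa using hb, ha, fun x hx => (h x hx).symm⟩

end Divisors

/-! ### Multiplication of sections by a fraction -/

section FractionSMul

variable {D : Type v} [AddCommGroup D] [DecidableEq D] {A : Type u} [CommRing A]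
variable {𝒜 : D → AddSubgroup A} [GradedRing 𝒜]
variable {M : Type u} [AddCommGroup M] [Module A M] {ℳ 𝒩 : D → AddSubgroup M}
  [SetLike.GradedSMul 𝒜 ℳ] [SetLike.GradedSMul 𝒜 𝒩]

/-- Multiplication by a fraction `b / c` maps sections of `M~` to sections of `N~`, where `N` is the
module `M` with another grading, if it maps homogeneous elements to homogeneous elements of the
right degree. -/
lemma fraction_smul_mem_sections {U : Opens (top 𝒜)} {b c : A} {k : D} (hc : c ∈ 𝒜 k)
    (hb : ∀ ⦃j : D⦄ ⦃m : M⦄, m ∈ ℳ j → b • m ∈ 𝒩 (k + j))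
    (h : ∀ y : U, c ∈ Point.compl (𝒜 := 𝒜) y.1)
    {s : ∀ y : U, Point.LocAt (𝒜 := 𝒜) M y.1} (hs : s ∈ sections 𝒜 ℳ U) :
    (fun y => Localization.mk b ⟨c, h y⟩ • s y) ∈ sections 𝒜 𝒩 U := by
  intro y
  obtain ⟨V, hV, iV, j, m, a, hm, ha, hs⟩ := hs y
  -- Where the section is `m / a`, the product is `(b • m) / (c * a)`. The assumption on `b` is what
  -- makes the degrees of numerator and denominator agree: both are `k + j`.
  refine ⟨V, hV, iV, k + j, b • m, c * a, hb hm, SetLike.mul_mem_graded hc ha, fun z => ?_⟩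
  obtain ⟨h1, e1⟩ := hs z
  exact ⟨mul_mem (h ⟨z.1, iV.le z.2⟩) h1,
    congr((Localization.mk b ⟨c, h ⟨z.1, iV.le z.2⟩⟩ : Localization _) • $e1).trans
      (LocalizedModule.mk_smul_mk ..)⟩

/-- The two scalars are inverse units of `S⁻¹A`, since their product is `(b * c) / (c * b)`. Applied
at each point, this gives both inverse laws of `sectionsEquiv`. -/
lemma fraction_smul_fraction_smul {S : Submonoid A} {b c : A} (hb : b ∈ S) (hc : c ∈ S)
    (z : LocalizedModule S M) :
    (Localization.mk b ⟨c, hc⟩ : Localization S) • (Localization.mk c ⟨b, hb⟩ : Localization S) • z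
      = z := by
  rw [smul_smul, Localization.mk_mul,
    show (b * c : A) = ((⟨c, hc⟩ * ⟨b, hb⟩ : S) : A) from mul_comm _ _, Localization.mk_self,
    one_smul]

/-- The isomorphism between the sections of `M~` and `N~` given by the multiplication by `b / c`. -/
def sectionsEquiv (U : Opens (top 𝒜)) {b c : A} {k l : D} (hbl : b ∈ 𝒜 l) (hck : c ∈ 𝒜 k)
    (hb : ∀ ⦃j : D⦄ ⦃m : M⦄, m ∈ ℳ j → b • m ∈ 𝒩 (k + j))
    (hc : ∀ ⦃j : D⦄ ⦃m : M⦄, m ∈ 𝒩 j → c • m ∈ ℳ (l + j))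
    (h : ∀ y : U, c ∈ Point.compl (𝒜 := 𝒜) y.1 ∧ b ∈ Point.compl (𝒜 := 𝒜) y.1) :
    sectionsModule 𝒜 ℳ U ≃ₗ[sectionsRing 𝒜 U] sectionsModule 𝒜 𝒩 U where
  -- Both gradings are on the same module `M`, so source and target lie in the same product of
  -- localizations. All identities below can thus be checked pointwise there, and the gradings
  -- matter only for membership.
  toFun s := ⟨_, fraction_smul_mem_sections hck hb (fun y => (h y).1) s.2⟩
  invFun s := ⟨_, fraction_smul_mem_sections hbl hc (fun y => (h y).2) s.2⟩
  map_add' _ _ := Subtype.ext (funext fun _ => smul_add _ _ _)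
  map_smul' r s := Subtype.ext (funext fun y => smul_comm
    (Localization.mk b ⟨c, (h y).1⟩ : Localization (Point.compl (𝒜 := 𝒜) y.1)) (r.1 y) (s.1 y))
  left_inv _ := Subtype.ext (funext fun y => fraction_smul_fraction_smul (h y).1 (h y).2 _)
  right_inv _ := Subtype.ext (funext fun y => fraction_smul_fraction_smul (h y).2 (h y).1 _)

end FractionSMul

/-! ### Local triviality of the twisted sheaf -/

section Twist

variable {D : Type v} [AddCommGroup D] [DecidableEq D] {A : Type u} [CommRing A]
variable {𝒜 : D → AddSubgroup A} [GradedRing 𝒜]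

/-- Linearity up to an identification of scalars: on a restricted sheaf a scalar acts through the
isomorphism `U.ι.appIso`, so it appears as `t` on one side and as `r` on the other. -/
lemma smul_equiv_of_eq {R M N : Type*} [Ring R] [AddCommGroup M] [AddCommGroup N] [Module R M]
    [Module R N] (e : M ≃ₗ[R] N) {r t : R} (h : t = r) (m : M) : r • e m = e (t • m) := by
  rw [h, map_smul]

/-- On an open set where the fraction `a / b` of degree `d` has neither zeros nor poles,
multiplication by `b / a` trivializes `O(d)`. -/
def twistedSheafTrivialization (U : (ProjMH 𝒜).Opens) {a b : A} {d i : D}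
    (ha : a ∈ 𝒜 (d + i)) (hb : b ∈ 𝒜 i)
    (h : ∀ y : Point 𝒜, y ∈ (show Opens (top 𝒜) from U) → a ∈ y.compl ∧ b ∈ y.compl) :
    (twistedSheaf 𝒜 d).restrict U.ι ≅
      (SheafOfModules.unit U.toScheme.ringCatSheaf : U.toScheme.Modules) := by
  -- Sections of the restricted sheaf over `V` are sections over its image in `X`, whose points all
  -- lie in `U`.
  have hU (V : U.toScheme.Opens) (y : Point 𝒜)
      (hy : y ∈ (show Opens (top 𝒜) from U.ι ''ᵁ V)) : a ∈ y.compl ∧ b ∈ y.compl := by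
    obtain ⟨z, -, rfl⟩ := hy
    exact h _ z.2
  -- The multiplier is `b / a`, with denominator `a` of degree `d + i`. An element of degree `j` in
  -- `A(d)` has degree `j + d` in `A`; this accounts for the two degree computations.
  let E (V : U.toScheme.Opens) := sectionsEquiv (𝒜 := 𝒜) (ℳ := shift 𝒜 d) (𝒩 := 𝒜)
    (U.ι ''ᵁ V) hb ha
    (fun j m hm => by
      rw [show d + i + j = i + (j + d) by abel]
      exact SetLike.mul_mem_graded hb hm)
    (fun j m hm => by
      change a * m ∈ 𝒜 (i + j + d)
      rw [show i + j + d = d + i + j by abel]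
      exact SetLike.mul_mem_graded ha hm) (fun y => hU V y.1 y.2)
  -- Full faithfulness of the passage to presheaves reduces the claim to isomorphisms on sections
  -- that respect scalars and restriction.
  refine (Scheme.Modules.fullyFaithfulToPresheafOfModules).preimageIso <|
    PresheafOfModules.isoMk (fun V => ?_) ?_
  · refine ModuleCat.isoMk (AddEquiv.toAddCommGrpIso (E V.unop).toAddEquiv) ?_
    intro r
    ext s
    -- For the inclusion of an open subscheme, the comparison of rings of sections is the identity.
    have hr : (U.ι.appIso V.unop).inv r = r := by
      rw [Scheme.Opens.ι_appIso]
      rfl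
    exact smul_equiv_of_eq (E V.unop) hr s
  · intro V W g
    ext s
    -- Restricting before or after multiplying gives the same value at each point, because one
    -- fraction `b / a` serves all open sets.
    exact Subtype.ext (funext fun y => rfl)

end Twist

end MultiProj
end

theorem mainTheorem1 {D : Type*} [AddCommGroup D] [AddGroup.FG D] [DecidableEq D]
    {A : Type*} [CommRing A] [IsDomain A] (𝒜 : D → AddSubgroup A) [GradedRing 𝒜]
    {r : ℕ} (x : Fin r → A) (hx : ∀ i, SetLike.IsHomogeneousElem 𝒜 (x i))
    (hgen : Algebra.adjoin (𝒜 0) (Set.range x) = ⊤)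
    (hfield : IsField (𝒜 0))
    (hunits : {a : A | IsUnit a} = Subtype.val '' {b : 𝒜 0 | IsUnit b})
    (d : D) (hd : ∀ f : A, MultiProj.IsRelevant 𝒜 f → d ∈ MultiProj.divisorDegrees 𝒜 f) :
    MultiProj.IsLineBundle (MultiProj.twistedSheaf 𝒜 d) := by
  intro p
  -- That the `D_+(f)` with `f` relevant cover `X` is built into the notion of point.
  obtain ⟨f, hf, hp⟩ := MultiProj.Point.exists_relevant (𝒜 := 𝒜) p
  obtain ⟨i, a, b, ha, hb, h⟩ := MultiProj.exists_fraction_of_mem_divisorDegrees hf.1 (hd f hf)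
  exact ⟨MultiProj.basicOpen 𝒜 hf.1, hp, ⟨MultiProj.twistedSheafTrivialization _ ha hb h⟩⟩
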